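/- Let $N$ be a prime number, let $H$ be a subgroup of the multiplicative group $\mathbb{Z}_N^{\times}$, and let $G=\mathbb{Z}_N\rtimes H$ be the semidirect product with multiplication $(x,a)(y,b)=(x+ay,\,ab)$. Then $G$ is irreducibly full spark, that is, every irreducible unitary representation of $G$ is full spark. Moreover, for every irreducible unitary representation $\pi$ of $G$ on a complex Hilbert space $\mathcal{H}$ there is a vector $v\in\mathcal{H}$ whose orbit $(\pi(g)v)_{g\in G}$ is a full spark, equal norm, tight frame for $\mathcal{H}$. Here a unitary representation is irreducible if its space is nonzero and has no invariant subspaces other than $0$ and itself. A finite family $(v_i)_{i\in I}$ in $\mathcal{H}$ is a frame if there are constants $0<A\le B$ with $A\|w\|^2\le\sum_{i\in I}|\langle w,v_i\rangle|^2\le B\|w\|^2$ for all $w\in\mathcal{H}$ (this forces $\dim\mathcal{H}<\infty$); it is tight if one can take $A=B$; it has equal norm if all $\|v_i\|$ coincide; it is full spark if it is a frame and, for every set $J\subseteq I$ of $\dim\mathcal{H}$ indices, the vectors $(v_i)_{i\in J}$ are linearly independent (so form a basis of $\mathcal{H}$). A unitary representation $\pi$ of a finite group $G$ on $\mathcal{H}$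 is full spark if $(\pi(g)v)_{g\in G}$ is a full spark frame for some $v\in\mathcal{H}$. -/

import Mathlib

/-! ### Finite frames -/

section Frames

variable {V : Type*} [NormedAddCommGroup V] [InnerProductSpace ℂ V] {ι : Type*} [Fintype ι]

/-- The finite family `v` is a frame for `V`: there are frame bounds `0 < A ≤ B`. -/
def IsFrame (v : ι → V) : Prop :=
  ∃ A B : ℝ, 0 < A ∧ A ≤ B ∧ ∀ w : V,
    A * ‖w‖ ^ 2 ≤ ∑ i, ‖inner ℂ (v i) w‖ ^ 2 ∧ ∑ i, ‖inner ℂ (v i) w‖ ^ 2 ≤ B * ‖w‖ ^ 2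

/-- A tight frame: a frame whose lower and upper frame bounds can be taken equal. -/
def IsTightFrame (v : ι → V) : Prop :=
  ∃ A : ℝ, 0 < A ∧ ∀ w : V, ∑ i, ‖inner ℂ (v i) w‖ ^ 2 = A * ‖w‖ ^ 2

/-- A full spark frame: a frame such that any `dim V` of its members (counted with their indices,
so that a repeated vector is a repetition) are linearly independent, i.e. form a basis of `V`.
No finite family is a frame of an infinite-dimensional space, so this forces `dim V < ∞`. -/
def IsFullSparkFrame (v : ι → V) : Prop :=
  IsFrame v ∧ ∀ s : Finset ι, s.card = Module.finrank ℂ V →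
    LinearIndependent ℂ (fun i : s => v i)

/-- All members of the family have the same norm. -/
def IsEqualNorm (v : ι → V) : Prop :=
  ∀ i j, ‖v i‖ = ‖v j‖

end Frames

/-! ### Unitary representations

A unitary representation of `G` on `V` is a homomorphism from `G` to the group `V ≃ₗᵢ[ℂ] V` of
surjective linear isometries, that is, of unitary operators of `V`. -/

section UnitaryRepresentations

variable {G : Type*} [Group G] {V : Type*} [NormedAddCommGroup V] [InnerProductSpace ℂ V]

/-- The linear representation that underlies a unitary representation. -/
def unitaryToRepresentation (π : G →* (V ≃ₗᵢ[ℂ] V)) : Representation ℂ G V where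
  toFun g := (π g).toLinearEquiv.toLinearMap
  map_one' := by
    ext v
    simp
  map_mul' g h := by
    ext v
    simp

/-- A unitary representation is irreducible if `V ≠ 0` and the only invariant subspaces
are `0` and `V`. -/
def IsIrreducibleUnitary (π : G →* (V ≃ₗᵢ[ℂ] V)) : Prop :=
  (unitaryToRepresentation π).IsIrreducible

/-- A unitary representation of a finite group is full spark if the orbit `(π(g)v)_{g ∈ G}`
of some vector `v` is a full spark frame. -/
def IsFullSparkRep [Fintype G] (π : G →* (V ≃ₗᵢ[ℂ] V)) : Prop :=
  ∃ v : V, IsFullSparkFrame (fun g : G => π g v)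

end UnitaryRepresentations

universe u

/-- A finite group is irreducibly full spark if each of its irreducible unitary representations
(on complex Hilbert spaces in an arbitrary universe `u`) is full spark. -/
def IsIrreduciblyFullSpark (G : Type*) [Group G] [Fintype G] : Prop :=
  ∀ (V : Type u) [NormedAddCommGroup V] [InnerProductSpace ℂ V] [CompleteSpace V]
    (π : G →* (V ≃ₗᵢ[ℂ] V)), IsIrreducibleUnitary π → IsFullSparkRep π

/-! ### The semidirect product `ℤ_N ⋊ H` -/

/-- The action of `ℤ_N^×` on the (multiplicatively written) additive group `ℤ_N` by
multiplication, `a · x = a x`. -/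
def zmodUnitsAut (N : ℕ) : (ZMod N)ˣ →* MulAut (Multiplicative (ZMod N)) :=
  (MulAutMultiplicative (ZMod N)).symm.toMonoidHom.comp
    (DistribMulAction.toAddAut (ZMod N)ˣ (ZMod N))

/-- The semidirect product `ℤ_N ⋊ H` for a subgroup `H` of `ℤ_N^×`, with the multiplication
`(x, a)(y, b) = (x + a y, a b)`. -/
abbrev ZModSemidirect (N : ℕ) (H : Subgroup (ZMod N)ˣ) : Type :=
  Multiplicative (ZMod N) ⋊[(zmodUnitsAut N).comp H.subtype] H

theorem ZModSemidirect.mul_eq (N : ℕ) (H : Subgroup (ZMod N)ˣ) (x y : ZMod N) (a b : H) :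
    ((⟨Multiplicative.ofAdd x, a⟩ * ⟨Multiplicative.ofAdd y, b⟩ : ZModSemidirect N H)) =
      ⟨Multiplicative.ofAdd (x + (a : (ZMod N)ˣ) * y), a * b⟩ :=
  rfl

noncomputable instance ZModSemidirect.instFintype (N : ℕ) [NeZero N] (H : Subgroup (ZMod N)ˣ) :
    Fintype (ZModSemidirect N H) :=
  haveI : Finite (ZModSemidirect N H) :=
    Finite.of_equiv (Multiplicative (ZMod N) × H) SemidirectProduct.equivProd.symm
  Fintype.ofFinite _

/-! An irreducible representation either is a line, when `ℤ_N` fixes a nonzero vector, or has an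
eigenvector `w` of the generator of `ℤ_N` with eigenvalue a primitive root `μ`. In the second case
the vectors `π (inr a) w` are a basis indexed by `H`, and the orbit of `∑ c_a π (inr a) w` has
coordinates `c_(b⁻¹a) μ^(a⁻¹x)` at `(x, b)`. Full spark thus says that all maximal minors of this
array are nonzero. With `c_a = t ^ 3 ^ k`, for distinct `k`, each minor is a polynomial in `t`. Its
coefficient at the largest exponent is, up to sign, a product of minors of the Fourier matrix of
order `N`, nonzero by Chebotarev (`IsPrimitiveRoot.det_of_pow_ne_zero`). One `t` then serves all
minors. Tightness comes from Schur's lemma, equal norm from unitarity. -/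

/-! ### Chebotarev's theorem, by reduction modulo `z - 1`. -/

open Polynomial in
theorem Polynomial.sum_mul_natCast_pow_eq_zero_of_X_sub_one_pow_dvd {R ι : Type*} [CommRing R]
    [Fintype ι] (e : ι → ℕ) (m : ℕ) (c : ι → R)
    (h : (X - 1 : R[X]) ^ (m + 1) ∣ ∑ j, C (c j) * X ^ e j) :
    ∑ j, c j * (e j : R) ^ m = 0 := by
  induction m generalizing c with
  | zero =>
    obtain ⟨q, hq⟩ := h
    simpa [eval_finsetSum] using congrArg (eval 1) hq
  | succ m ih =>
    -- The operator `X d/dX` multiplies each coefficient by its exponent and costs at most one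
    -- factor `X - 1`.
    have key : X * derivative (∑ j, C (c j) * X ^ e j : R[X]) =
        ∑ j, C (c j * e j) * X ^ e j := by
      rw [derivative_sum, Finset.mul_sum]
      refine Finset.sum_congr rfl fun j _ => ?_
      rcases Nat.eq_zero_or_pos (e j) with h0 | h0
      · simp [h0]
      · rw [derivative_C_mul_X_pow, mul_left_comm, ← pow_succ', Nat.sub_add_cancel h0]
    have := ih (fun j => c j * e j) <| by
      rw [← key]
      exact (pow_sub_one_dvd_derivative_of_pow_dvd h).mul_left X
    simpa only [pow_succ', mul_assoc] using this

-- The vanishing moments form a Vandermonde system with distinct nodes `e j`.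
open Polynomial in
theorem Polynomial.eq_zero_of_X_sub_one_pow_card_dvd {R ι : Type*} [CommRing R] [IsDomain R]
    [Fintype ι] (e : ι → ℕ) (he : Function.Injective fun j => (e j : R)) (c : ι → R)
    (h : (X - 1 : R[X]) ^ Fintype.card ι ∣ ∑ j, C (c j) * X ^ e j) : c = 0 := by
  let f := Fintype.equivFin ι
  have hz := Matrix.eq_zero_of_forall_pow_sum_mul_pow_eq_zero (R := R)
    (f := fun i => (e (f.symm i) : R)) (v := fun i => c (f.symm i))
    (he.comp f.symm.injective) fun i => by
      have := sum_mul_natCast_pow_eq_zero_of_X_sub_one_pow_dvd e i c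
        ((pow_dvd_pow _ i.2).trans h)
      rw [← this]
      exact Equiv.sum_comp f.symm (fun j => c j * (e j : R) ^ (i : ℕ))
  funext j
  simpa using congrFun hz (f j)

theorem IsPrimitiveRoot.sub_one_dvd_natCast_prime {R : Type*} [CommRing R] [IsDomain R] {p : ℕ}
    [hp : Fact p.Prime] {z : R} (hz : IsPrimitiveRoot z p) : z - 1 ∣ (p : R) := by
  have h := Polynomial.sub_dvd_eval_sub z 1 (Polynomial.cyclotomic p R)
  rwa [Polynomial.eval_one_cyclotomic_prime, (hz.isRoot_cyclotomic hp.out.pos).eq_zero,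
    zero_sub, dvd_neg] at h

-- The polynomial `∑ c_j X^(b_j)` has the distinct roots `z^(a_i)`, all of which become `1` modulo
-- `z - 1`. The quotient has characteristic `p`, so the exponents stay distinct there.
open Polynomial in
theorem IsPrimitiveRoot.sub_one_dvd_of_sum_mul_pow_eq_zero {R ι : Type*} [CommRing R] [IsDomain R]
    [Fintype ι] {p : ℕ} [hp : Fact p.Prime] {z : R} (hz : IsPrimitiveRoot z p)
    (hprime : Prime (z - 1)) {a b : ι → ZMod p} (ha : Function.Injective a)
    (hb : Function.Injective b) (c : ι → R)
    (hc : ∀ i, ∑ j, c j * z ^ ((a i).val * (b j).val) = 0) (j : ι) : z - 1 ∣ c j := by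
  classical
  let I := Ideal.span {z - 1}
  have : I.IsPrime := (Ideal.span_singleton_prime hprime.ne_zero).2 hprime
  let q := Ideal.Quotient.mk I
  have hq : ∀ r, q r = 0 ↔ z - 1 ∣ r := fun r => by
    rw [Ideal.Quotient.eq_zero_iff_mem, Ideal.mem_span_singleton]
  have hzq : q z = 1 := by
    rw [← sub_eq_zero, ← map_one q, ← map_sub, hq]
  have hpq : (p : R ⧸ I) = 0 := by
    rw [← map_natCast q, hq]
    exact hz.sub_one_dvd_natCast_prime
  have : CharP (R ⧸ I) p := (CharP.ringChar_of_prime_eq_zero hp.out hpq) ▸ ringChar.charP _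
  let g : R[X] := ∑ j, C (c j) * X ^ (b j).val
  have hg : ∏ i, (X - C (z ^ (a i).val)) ∣ g := by
    by_cases h0 : g = 0
    · rw [h0]; exact dvd_zero _
    have hinj : Function.Injective fun i => z ^ (a i).val := fun i k h =>
      ha (ZMod.val_injective p (hz.pow_inj (ZMod.val_lt _) (ZMod.val_lt _) h))
    have := (Multiset.prod_X_sub_C_dvd_iff_le_roots h0
      (Finset.univ.val.map fun i => z ^ (a i).val)).2 <| by
      rw [Multiset.le_iff_subset (Finset.univ.nodup.map hinj)]
      intro y hy
      obtain ⟨i, -, rfl⟩ := Multiset.mem_map.1 hy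
      rw [mem_roots h0, IsRoot.def]
      simpa [g, eval_finsetSum, ← pow_mul] using hc i
    simpa [Multiset.map_map] using this
  have hd := map_dvd (mapRingHom q) hg
  have h0 := eq_zero_of_X_sub_one_pow_card_dvd (R := R ⧸ I) (fun j => (b j).val)
    (fun i k h => hb <| ZMod.val_injective p <|
      CharP.natCast_injOn_Iio (R ⧸ I) p (ZMod.val_lt _) (ZMod.val_lt _) h)
    (fun j => q (c j)) <| by
      simpa [g, Polynomial.map_prod, Polynomial.map_sum, hzq, Finset.prod_const] using hd
  exact (hq _).1 (congrFun h0 j)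

/-- Infinite descent: a solution divided by `z - 1` is again a solution. -/
theorem IsPrimitiveRoot.eq_zero_of_sum_mul_pow_eq_zero_of_prime_sub_one {R ι : Type*} [CommRing R]
    [IsDomain R] [WfDvdMonoid R] [Fintype ι] {p : ℕ} [hp : Fact p.Prime] {z : R}
    (hz : IsPrimitiveRoot z p) (hprime : Prime (z - 1)) {a b : ι → ZMod p}
    (ha : Function.Injective a) (hb : Function.Injective b) (c : ι → R)
    (hc : ∀ i, ∑ j, c j * z ^ ((a i).val * (b j).val) = 0) : c = 0 := by
  have key : ∀ (m : ℕ) (c : ι → R), (∀ i, ∑ j, c j * z ^ ((a i).val * (b j).val) = 0) →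
      ∀ j, (z - 1) ^ m ∣ c j := by
    intro m
    induction m with
    | zero => simp
    | succ m ih =>
      intro c hc j
      choose d hd using hz.sub_one_dvd_of_sum_mul_pow_eq_zero hprime ha hb c hc
      rw [hd j, pow_succ']
      refine mul_dvd_mul_left _ (ih d (fun i => ?_) j)
      refine (mul_eq_zero.1 ?_).resolve_left hprime.ne_zero
      rw [Finset.mul_sum, ← hc i]
      exact Finset.sum_congr rfl fun k _ => by rw [hd k, mul_assoc]
  funext j
  by_contra h
  obtain ⟨m, hm⟩ := FiniteMultiplicity.of_not_isUnit hprime.not_isUnit h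
  exact hm (key _ c hc j)

/-- **Chebotarev's theorem on roots of unity**: the minors of the discrete Fourier matrix of prime
order do not vanish. -/
theorem IsPrimitiveRoot.det_of_pow_ne_zero {ι : Type*} [Fintype ι] [DecidableEq ι] {p : ℕ}
    [hp : Fact p.Prime] {ζ : ℂ} (hζ : IsPrimitiveRoot ζ p) {a b : ι → ZMod p}
    (ha : Function.Injective a) (hb : Function.Injective b) :
    (Matrix.of fun i j => ζ ^ (a i * b j).val).det ≠ 0 := by
  obtain ⟨K, _, _, _⟩ : ∃ (K : Type) (_ : Field K) (_ : NumberField K),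
      IsCyclotomicExtension {p} ℚ K :=
    ⟨CyclotomicField p ℚ, inferInstance, inferInstance, by
      convert CyclotomicField.isCyclotomicExtension p ℚ
      · rfl
      · exact Subsingleton.elim _ _⟩
  have hK := IsCyclotomicExtension.zeta_spec p ℚ K
  let φ : K →+* ℂ := (IsAlgClosed.lift : K →ₐ[ℚ] ℂ).toRingHom
  -- The embedding `φ` need not send the chosen root to `ζ`; a power of that root prime to `p` does
  -- map to `ζ`.
  obtain ⟨m, -, hm, hmζ⟩ := (hK.map_of_injective φ.injective).isPrimitiveRoot_iff.1 hζ
  have hz := (hK.pow_of_coprime m hm).toInteger_isPrimitiveRoot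
  set z := (hK.pow_of_coprime m hm).toInteger
  let ψ : NumberField.RingOfIntegers K →+* ℂ := φ.comp (algebraMap _ K)
  have hψ : Function.Injective ψ :=
    φ.injective.comp (FaithfulSMul.algebraMap_injective _ _)
  have hψz : ψ z = ζ := by
    rw [← hmζ, ← map_pow]; rfl
  have hpow : ∀ x y : ZMod p, ζ ^ (x * y).val = ψ (z ^ (x.val * y.val)) := fun x y => by
    rw [map_pow, hψz, ZMod.val_mul]
    exact (pow_eq_pow_mod _ hζ.pow_eq_one).symm
  intro hdet
  have hM : (Matrix.of fun i j => ζ ^ (a i * b j).val) =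
      (Matrix.of fun i j => z ^ ((a i).val * (b j).val)).map ψ := by
    ext i j; exact hpow _ _
  rw [hM, ← RingHom.mapMatrix_apply, ← RingHom.map_det, map_eq_zero_iff ψ hψ] at hdet
  obtain ⟨c, hc, h⟩ := Matrix.exists_mulVec_eq_zero_iff.2 hdet
  refine hc (hz.eq_zero_of_sum_mul_pow_eq_zero_of_prime_sub_one
    (hK.pow_of_coprime m hm).zeta_sub_one_prime' ha hb c fun i => ?_)
  refine Eq.trans ?_ (congrFun h i)
  exact Finset.sum_congr rfl fun j _ => mul_comm _ _

/-! ### Optimal assignments of rows to blocks. -/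

/-- Exchange argument for the assignment problem with superincreasing weights `3 ^ e (β i) (σ i)`:
at the largest weight where an optimal assignment `σ` and another assignment `τ` differ, the
weight is not the one used by `τ`. -/
theorem Equiv.Perm.not_lt_of_isMax_sum_three_pow {I B : Type*} [Fintype I] [DecidableEq I]
    (β : I → B) (e : B → I → ℕ) (he : ∀ b, Function.Injective (e b)) {σ τ : Equiv.Perm I}
    (hσ : ∀ ρ : Equiv.Perm I, ∑ i, 3 ^ e (β i) (ρ i) ≤ ∑ i, 3 ^ e (β i) (σ i)) (a : I)
    (hne : β (σ.symm a) ≠ β (τ.symm a))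
    (hmax : ∀ a', β (σ.symm a') ≠ β (τ.symm a') →
      e (β (σ.symm a')) a' ≤ e (β (τ.symm a)) a ∧ e (β (τ.symm a')) a' ≤ e (β (τ.symm a)) a) :
    ¬ e (β (σ.symm a)) a < e (β (τ.symm a)) a := by
  classical
  intro hlt
  set b := β (τ.symm a) with hb
  set k := e b a with hk
  -- Otherwise, by maximality of `k`, the rows `σ` gives to block `b` lie among those of `τ`, hence
  -- coincide with them; but only `τ` gives `a` to `b`.
  obtain ⟨j, hjb, hjk⟩ : ∃ j, β j = b ∧ e b (σ j) < k := by
    by_contra! hcon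
    let S := Finset.univ.filter fun j => β j = b
    have hsub : S.map σ.toEmbedding ⊆ S.map τ.toEmbedding := by
      intro a' ha'
      simp only [S, Finset.mem_map_equiv, Finset.mem_filter, Finset.mem_univ, true_and] at ha' ⊢
      by_contra hb'
      have h1 := (hmax a' fun h => hb' (h ▸ ha')).1
      have h2 := hcon _ ha'
      rw [ha'] at h1
      rw [Equiv.apply_symm_apply] at h2
      have : a' = a := he b (le_antisymm h1 h2)
      exact hne (this ▸ ha')
    have heq := Finset.eq_of_subset_of_card_le hsub (by simp)
    have : a ∈ S.map τ.toEmbedding := by simp [S, hb]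
    rw [← heq] at this
    exact hne (by simpa [S] using this)
  have hij : σ.symm a ≠ j := fun h => hne (h ▸ hjb)
  have hrest : ∀ ρ : Equiv.Perm I, ∑ i, 3 ^ e (β i) (ρ i) =
      3 ^ e (β (σ.symm a)) (ρ (σ.symm a)) + (3 ^ e b (ρ j) +
        ∑ i ∈ (Finset.univ.erase (σ.symm a)).erase j, 3 ^ e (β i) (ρ i)) := fun ρ => by
    rw [← hjb, Finset.add_sum_erase _ (fun i => 3 ^ e (β i) (ρ i))
      (Finset.mem_erase.2 ⟨hij.symm, Finset.mem_univ j⟩),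
      Finset.add_sum_erase _ (fun i => 3 ^ e (β i) (ρ i)) (Finset.mem_univ _)]
  -- The swap gains `3 ^ k` and loses at most `2 * 3 ^ (k - 1)`.
  have h := hσ (σ * Equiv.swap (σ.symm a) j)
  rw [hrest, hrest σ] at h
  have hsum : ∑ i ∈ (Finset.univ.erase (σ.symm a)).erase j,
      3 ^ e (β i) ((σ * Equiv.swap (σ.symm a) j) i) =
      ∑ i ∈ (Finset.univ.erase (σ.symm a)).erase j, 3 ^ e (β i) (σ i) := by
    refine Finset.sum_congr rfl fun i hi => ?_
    simp only [Finset.mem_erase] at hi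
    rw [Equiv.Perm.mul_apply, Equiv.swap_apply_of_ne_of_ne hi.2.1 hi.1]
  rw [hsum] at h
  simp only [Equiv.Perm.mul_apply, Equiv.swap_apply_left, Equiv.swap_apply_right,
    Equiv.apply_symm_apply] at h
  have hpos : 0 < 3 ^ e (β (σ.symm a)) (σ j) := by positivity
  obtain ⟨m, hm⟩ : ∃ m, k = m + 1 := ⟨k - 1, by omega⟩
  have h1 : 3 ^ e (β (σ.symm a)) a ≤ 3 ^ m := Nat.pow_le_pow_right (by norm_num) (by omega)
  have h2 : 3 ^ e b (σ j) ≤ 3 ^ m := Nat.pow_le_pow_right (by norm_num) (by omega)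
  have h3 : 3 ^ e b a = 3 * 3 ^ m := by rw [← hk, hm, pow_succ']
  have h4 : 0 < 3 ^ m := by positivity
  omega

/-- At a disagreement of largest weight a tie contradicts `he'`; otherwise the exchange improves the
assignment with the smaller weight there. -/
theorem Equiv.Perm.apply_symm_eq_of_isMax_sum_three_pow {I B : Type*} [Fintype I] [DecidableEq I]
    (β : I → B) (e : B → I → ℕ) (he : ∀ b, Function.Injective (e b))
    (he' : ∀ a, Function.Injective fun b => e b a) {σ τ : Equiv.Perm I}
    (hσ : ∀ ρ : Equiv.Perm I, ∑ i, 3 ^ e (β i) (ρ i) ≤ ∑ i, 3 ^ e (β i) (σ i))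
    (hτ : ∀ ρ : Equiv.Perm I, ∑ i, 3 ^ e (β i) (ρ i) ≤ ∑ i, 3 ^ e (β i) (τ i)) (a : I) :
    β (σ.symm a) = β (τ.symm a) := by
  classical
  by_contra hne
  obtain ⟨a₀, h₀, hmax⟩ := Finset.exists_max_image
    (Finset.univ.filter fun a => β (σ.symm a) ≠ β (τ.symm a))
    (fun a => max (e (β (σ.symm a)) a) (e (β (τ.symm a)) a)) ⟨a, by simpa using hne⟩
  simp only [Finset.mem_filter, Finset.mem_univ, true_and] at h₀ hmax
  rcases lt_trichotomy (e (β (σ.symm a₀)) a₀) (e (β (τ.symm a₀)) a₀) with h | h | h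
  · refine not_lt_of_isMax_sum_three_pow β e he hσ a₀ h₀ (fun a' ha' => ?_) h
    simpa [max_eq_right h.le] using hmax a' ha'
  · exact h₀ (he' a₀ h)
  · refine not_lt_of_isMax_sum_three_pow β e he hτ a₀ h₀.symm (fun a' ha' => ?_) h
    simpa [max_eq_left h.le, and_comm] using hmax a' ha'.symm

/-! ### Generic weights make all minors nonzero. -/

/-- Reordering the rows by `σ` makes the matrix block diagonal, with Fourier minors as blocks. -/
theorem IsPrimitiveRoot.det_block_of_pow_ne_zero {I B : Type*} [Fintype I] [DecidableEq I]
    [DecidableEq B] {p : ℕ} [Fact p.Prime] {ζ : ℂ} (hζ : IsPrimitiveRoot ζ p) (β : I → B)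
    {x y : I → ZMod p} (hy : Function.Injective y)
    (hx : Function.Injective fun i => (β i, x i)) (σ : Equiv.Perm I) :
    (Matrix.of fun a i => if β i = β (σ.symm a) then ζ ^ (y a * x i).val else 0).det ≠ 0 := by
  intro hdet
  obtain ⟨v, hv, h⟩ := Matrix.exists_mulVec_eq_zero_iff.2 hdet
  refine hv (funext fun i₀ => ?_)
  have hblock := hζ.det_of_pow_ne_zero (ι := {i // β i = β i₀}) (a := fun j => y (σ j))
    (b := fun i => x i) (fun j k hjk => Subtype.ext (σ.injective (hy hjk)))
    (fun j k hjk => Subtype.ext (hx (Prod.ext (j.2.trans k.2.symm) hjk)))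
  have hzero := Matrix.eq_zero_of_mulVec_eq_zero hblock (v := fun i => v i) <| by
    funext j
    refine Eq.trans ?_ (congrFun h (σ j))
    simp only [Matrix.mulVec, dotProduct, Matrix.of_apply, Equiv.symm_apply_apply, j.2, ite_mul,
      zero_mul]
    rw [← Finset.sum_filter]
    exact Finset.sum_subtype _ (fun i => by simp)
      (fun i => ζ ^ (y (σ j) * x i).val * v i) |>.symm
  exact congrFun hzero ⟨i₀, rfl⟩

open Polynomial in
theorem IsPrimitiveRoot.det_C_pow_mul_X_pow_ne_zero {I B : Type*} [Fintype I] [DecidableEq I]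
    {p : ℕ} [Fact p.Prime] {ζ : ℂ} (hζ : IsPrimitiveRoot ζ p) (β : I → B)
    {x y : I → ZMod p} (hy : Function.Injective y)
    (hx : Function.Injective fun i => (β i, x i)) (e : B → I → ℕ)
    (he : ∀ b, Function.Injective (e b)) (he' : ∀ a, Function.Injective fun b => e b a) :
    (Matrix.of fun a i => C (ζ ^ (y a * x i).val) * X ^ 3 ^ e (β i) a : Matrix I I ℂ[X]).det
      ≠ 0 := by
  classical
  obtain ⟨σ, hσ⟩ := Finite.exists_max fun ρ : Equiv.Perm I => ∑ i, 3 ^ e (β i) (ρ i)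
  intro hdet
  refine hζ.det_block_of_pow_ne_zero β hy hx σ ?_
  refine Eq.trans ?_ ((congrArg (coeff · (∑ i, 3 ^ e (β i) (σ i))) hdet).trans (coeff_zero _))
  rw [Matrix.det_apply, Matrix.det_apply, finsetSum_coeff]
  refine Finset.sum_congr rfl fun ρ _ => ?_
  simp only [Matrix.of_apply, Finset.prod_mul_distrib, Finset.prod_pow_eq_pow_sum, coeff_smul]
  rw [← map_prod, coeff_C_mul_X_pow]
  congr 1
  -- The terms of top exponent come exactly from the permutations inducing the same blocks as `σ`,
  -- so the coefficient is the block determinant.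
  have hiff : (∑ i, 3 ^ e (β i) (σ i) = ∑ i, 3 ^ e (β i) (ρ i)) ↔
      ∀ i, β i = β (σ.symm (ρ i)) := by
    constructor
    · intro h i
      have := Equiv.Perm.apply_symm_eq_of_isMax_sum_three_pow β e he he' (σ := ρ) (τ := σ)
        (fun τ => (hσ τ).trans h.le) hσ (ρ i)
      rwa [Equiv.symm_apply_apply] at this
    · intro h
      rw [← Equiv.sum_comp (ρ.trans σ.symm) fun i => 3 ^ e (β i) (σ i)]
      refine Finset.sum_congr rfl fun i _ => ?_
      rw [Equiv.trans_apply, Equiv.apply_symm_apply, ← h i]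
  rw [Finset.prod_ite_zero]
  simp [hiff]

open Polynomial in
theorem Polynomial.exists_forall_eval_ne_zero {R κ : Type*} [CommRing R] [IsDomain R] [Infinite R]
    [Finite κ] (f : κ → R[X]) (hf : ∀ k, f k ≠ 0) : ∃ t, ∀ k, (f k).eval t ≠ 0 := by
  have := Fintype.ofFinite κ
  by_contra! h
  refine Finset.prod_ne_zero_iff.2 (fun k (_ : k ∈ Finset.univ) => hf k)
    (Polynomial.funext fun t => ?_)
  obtain ⟨k, hk⟩ := h t
  rw [eval_prod, eval_zero, Finset.prod_eq_zero (Finset.mem_univ k) hk]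

/-- For pairwise distinct frequencies `y a` there are nonzero weights `c` for which any `|I|` of the
vectors `(c (e b a) ζ ^ (y a * x))_a`, indexed by the pairs `(b, x)`, are linearly independent. -/
theorem IsPrimitiveRoot.exists_forall_det_ne_zero {I B : Type*} [Fintype I] [DecidableEq I]
    [Finite B] {p : ℕ} [Fact p.Prime] {ζ : ℂ} (hζ : IsPrimitiveRoot ζ p) {y : I → ZMod p}
    (hy : Function.Injective y) (e : B → I → ℕ) (he : ∀ b, Function.Injective (e b))
    (he' : ∀ a, Function.Injective fun b => e b a) :
    ∃ c : ℕ → ℂ, (∀ k, c k ≠ 0) ∧ ∀ f : I → B × ZMod p, Function.Injective f →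
      (Matrix.of fun a i => c (e (f i).1 a) * ζ ^ (y a * (f i).2).val).det ≠ 0 := by
  open Polynomial in
  -- The extra polynomial `X`, at `none`, forces `t ≠ 0`.
  obtain ⟨t, ht⟩ := exists_forall_eval_ne_zero
    (fun k : Option {f : I → B × ZMod p // Function.Injective f} => k.elim (X : ℂ[X]) fun f =>
      (Matrix.of fun a i => C (ζ ^ (y a * (f.1 i).2).val) * X ^ 3 ^ e (f.1 i).1 a).det) <| by
    rintro (_ | f)
    · exact X_ne_zero
    · exact hζ.det_C_pow_mul_X_pow_ne_zero (fun i => (f.1 i).1) hy f.2 e he he'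
  refine ⟨fun k => t ^ 3 ^ k, fun k => pow_ne_zero _ (by simpa using ht none), fun f hf => ?_⟩
  convert ht (some ⟨f, hf⟩)
  rw [Option.elim_some, ← Polynomial.coe_evalRingHom, RingHom.map_det]
  congr 1
  ext a i
  simp [mul_comm]

/-! ### Irreducible unitary representations. -/

theorem unitaryRep_mul_apply {G : Type*} [Group G] {V : Type*} [NormedAddCommGroup V]
    [InnerProductSpace ℂ V] (π : G →* (V ≃ₗᵢ[ℂ] V)) (g h : G) (v : V) :
    π (g * h) v = π g (π h v) := by
  rw [map_mul]; rfl

namespace IsIrreducibleUnitary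

variable {G : Type*} [Group G] {V : Type*} [NormedAddCommGroup V] [InnerProductSpace ℂ V]
  {π : G →* (V ≃ₗᵢ[ℂ] V)}

theorem eq_bot_or_eq_top (hπ : IsIrreducibleUnitary π) (S : Submodule ℂ V)
    (hS : ∀ g, ∀ v ∈ S, π g v ∈ S) : S = ⊥ ∨ S = ⊤ := by
  have : IsSimpleOrder (Subrepresentation (unitaryToRepresentation π)) := hπ
  exact (IsSimpleOrder.eq_bot_or_eq_top
    (⟨S, hS⟩ : Subrepresentation (unitaryToRepresentation π))).imp
    (congrArg Subrepresentation.toSubmodule) (congrArg Subrepresentation.toSubmodule)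

theorem nontrivial (hπ : IsIrreducibleUnitary π) : Nontrivial V := by
  have : IsSimpleOrder (Subrepresentation (unitaryToRepresentation π)) := hπ
  by_contra h
  rw [not_nontrivial_iff_subsingleton] at h
  exact bot_ne_top (α := Subrepresentation (unitaryToRepresentation π))
    (Subrepresentation.toSubmodule_injective (Subsingleton.elim _ _))

theorem eq_top_of_mem (hπ : IsIrreducibleUnitary π) (S : Submodule ℂ V)
    (hS : ∀ g, ∀ v ∈ S, π g v ∈ S) {v : V} (hv : v ∈ S) (hv0 : v ≠ 0) : S = ⊤ :=
  (hπ.eq_bot_or_eq_top S hS).resolve_left fun h => hv0 (by rwa [h, Submodule.mem_bot] at hv)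

theorem finiteDimensional [Finite G] (hπ : IsIrreducibleUnitary π) : FiniteDimensional ℂ V := by
  have := hπ.nontrivial
  obtain ⟨v, hv⟩ := exists_ne (0 : V)
  have htop := hπ.eq_top_of_mem (Submodule.span ℂ (Set.range fun g => π g v)) (fun g w hw => by
    induction hw using Submodule.span_induction with
    | mem w hw =>
      obtain ⟨k, rfl⟩ := hw
      exact Submodule.subset_span ⟨g * k, by simp⟩
    | zero => simp
    | add x y _ _ hx hy => rw [map_add]; exact add_mem hx hy
    | smul c x _ hx => rw [map_smul]; exact Submodule.smul_mem _ c hx)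
    (Submodule.subset_span ⟨1, rfl⟩) (by simpa using hv)
  exact Module.finite_def.2 (htop ▸ Submodule.fg_span (Set.finite_range _))

/-- **Schur's lemma**: an operator that commutes with an irreducible representation is scalar. -/
theorem exists_eq_smul [FiniteDimensional ℂ V] (hπ : IsIrreducibleUnitary π)
    (T : Module.End ℂ V) (hT : ∀ g v, T (π g v) = π g (T v)) : ∃ c : ℂ, ∀ v, T v = c • v := by
  have := hπ.nontrivial
  obtain ⟨c, hc⟩ := Module.End.exists_eigenvalue T
  obtain ⟨v, hv, hv0⟩ := hc.exists_hasEigenvector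
  have htop := hπ.eq_top_of_mem (Module.End.eigenspace T c) (fun g w hw => by
    rw [Module.End.mem_eigenspace_iff] at hw ⊢
    rw [hT, hw, map_smul]) hv hv0
  exact ⟨c, fun w => Module.End.mem_eigenspace_iff.1 (htop ▸ Submodule.mem_top)⟩

/-- The frame operator `S` commutes with `π`, so it is scalar; testing on `v` itself shows that the
scalar is positive. -/
theorem isTightFrame [Fintype G] (hπ : IsIrreducibleUnitary π) {v : V} (hv : v ≠ 0) :
    IsTightFrame fun g => π g v := by
  have := hπ.finiteDimensional
  let S : Module.End ℂ V := ∑ g, (innerSL ℂ (π g v)).toLinearMap.smulRight (π g v)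
  have hS : ∀ w, S w = ∑ g, inner ℂ (π g v) w • π g v := fun w => by simp [S]
  obtain ⟨c, hc⟩ := hπ.exists_eq_smul S fun h w => by
    rw [hS, hS, map_sum, ← Equiv.sum_comp (Equiv.mulLeft h)]
    simp
  have key : ∀ w, ∑ g, ‖inner ℂ (π g v) w‖ ^ 2 = c.re * ‖w‖ ^ 2 := fun w => by
    have h : inner ℂ w (S w) = ((∑ g, ‖inner ℂ (π g v) w‖ ^ 2 : ℝ) : ℂ) := by
      rw [hS, inner_sum]
      push_cast
      refine Finset.sum_congr rfl fun g _ => ?_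
      rw [inner_smul_right, ← inner_conj_symm w, Complex.mul_conj']
    rw [hc, inner_smul_right, inner_self_eq_norm_sq_to_K] at h
    have := congrArg Complex.re h
    rw [Complex.ofReal_re] at this
    rw [← this]
    simp [← Complex.ofReal_pow]
  refine ⟨c.re, ?_, key⟩
  have h1 : 0 < ∑ g, ‖inner ℂ (π g v) v‖ ^ 2 :=
    Finset.sum_pos' (fun _ _ => by positivity) ⟨1, Finset.mem_univ _, by simp [hv]⟩
  rw [key] at h1
  exact pos_of_mul_pos_left h1 (by positivity)

/-- If the operators of an irreducible representation commute, its space is a line. -/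
theorem finrank_eq_one_of_commute [FiniteDimensional ℂ V] (hπ : IsIrreducibleUnitary π)
    (hcomm : ∀ g h v, π g (π h v) = π h (π g v)) : Module.finrank ℂ V = 1 := by
  have := hπ.nontrivial
  obtain ⟨v, hv⟩ := exists_ne (0 : V)
  have htop := hπ.eq_top_of_mem (ℂ ∙ v) (fun g w hw => by
    obtain ⟨c, hc⟩ := hπ.exists_eq_smul (unitaryToRepresentation π g) fun h w => hcomm g h w
    exact (hc w : π g w = c • w) ▸ Submodule.smul_mem _ c hw)
    (Submodule.mem_span_singleton_self v) hv
  rw [← finrank_top, ← htop, finrank_span_singleton hv]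

end IsIrreducibleUnitary

theorem IsTightFrame.isFrame {V : Type*} [NormedAddCommGroup V] [InnerProductSpace ℂ V]
    {ι : Type*} [Fintype ι] {v : ι → V} (hv : IsTightFrame v) : IsFrame v :=
  let ⟨A, hA, h⟩ := hv
  ⟨A, A, hA, le_rfl, fun w => ⟨(h w).ge, (h w).le⟩⟩

/-! ### Irreducible representations of `ℤ_N ⋊ H`. -/

namespace ZModSemidirect

open SemidirectProduct

variable {N : ℕ} [Fact N.Prime] {H : Subgroup (ZMod N)ˣ} {V : Type*} [NormedAddCommGroup V]
  [InnerProductSpace ℂ V] {π : ZModSemidirect N H →* (V ≃ₗᵢ[ℂ] V)}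

theorem inl_mul_inr (x : ZMod N) (a : H) :
    (inl (Multiplicative.ofAdd x) * inr a : ZModSemidirect N H) =
      inr a * inl (Multiplicative.ofAdd (((a⁻¹ : H) : (ZMod N)ˣ) * x : ZMod N)) := by
  refine SemidirectProduct.ext ?_ ?_
  · change x + ((1 : H) : (ZMod N)ˣ) * (0 : ZMod N) =
      0 + ((a : H) : (ZMod N)ˣ) * (((a⁻¹ : H) : (ZMod N)ˣ) * x : ZMod N)
    rw [mul_zero, add_zero, zero_add, ← mul_assoc, ← Units.val_mul, ← Subgroup.coe_mul,
      mul_inv_cancel, Subgroup.coe_one, Units.val_one, one_mul]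
  · simp only [mul_right, right_inl, right_inr, one_mul, mul_one]

theorem apply_inl_of_apply_inl_one {μ : ℂ} {w : V}
    (hw : π (inl (Multiplicative.ofAdd 1)) w = μ • w) (x : ZMod N) :
    π (inl (Multiplicative.ofAdd x)) w = μ ^ x.val • w := by
  have h : ∀ n : ℕ, π (inl (Multiplicative.ofAdd (n : ZMod N))) w = μ ^ n • w := by
    intro n
    induction n with
    | zero => simp
    | succ n ih =>
      rw [Nat.cast_succ, add_comm, ofAdd_add, map_mul, unitaryRep_mul_apply, ih,
        map_smul, hw, smul_smul, pow_succ]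
  simpa using h x.val

/-- The vectors fixed by the normal subgroup `ℤ_N` form an invariant subspace, hence everything, so
`π` factors through the abelian group `H`. -/
theorem finrank_eq_one_of_apply_inl_eq [FiniteDimensional ℂ V] (hπ : IsIrreducibleUnitary π)
    {w : V} (hw0 : w ≠ 0) (hw : ∀ x, π (inl x) w = w) : Module.finrank ℂ V = 1 := by
  let S : Submodule ℂ V := ⨅ x, Module.End.eigenspace (unitaryToRepresentation π (inl x)) 1
  have hS : ∀ v, v ∈ S ↔ ∀ x, π (inl x) v = v := fun v => by
    simp only [S, Submodule.mem_iInf, Module.End.mem_eigenspace_iff, one_smul]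
    rfl
  have hker : ∀ g : ZModSemidirect N H, g.right = 1 → ∃ x, g = inl x := fun g hg =>
    ⟨g.left, SemidirectProduct.ext rfl hg⟩
  have htop := hπ.eq_top_of_mem S (fun g v hv => (hS _).2 fun x => by
    obtain ⟨y, hy⟩ := hker (g⁻¹ * inl x * g) (by simp)
    have : inl x * g = g * inl y := by rw [← hy]; group
    rw [← unitaryRep_mul_apply, this, unitaryRep_mul_apply,
      (hS v).1 hv]) ((hS w).2 hw) hw0
  refine hπ.finrank_eq_one_of_commute fun g h v => ?_
  obtain ⟨y, hy⟩ := hker ((h * g)⁻¹ * (g * h)) <| by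
    rw [mul_right, inv_right, mul_right, mul_right, mul_comm h.right, inv_mul_cancel]
  have : g * h = h * g * inl y := by rw [← hy]; group
  rw [← unitaryRep_mul_apply, this, unitaryRep_mul_apply,
    (hS v).1 (htop ▸ Submodule.mem_top), unitaryRep_mul_apply]

theorem apply_inl_apply_inr {μ : ℂ} {w : V}
    (hw : π (inl (Multiplicative.ofAdd 1)) w = μ • w) (x : ZMod N) (a : H) :
    π (inl (Multiplicative.ofAdd x)) (π (inr a) w) =
      μ ^ (((a⁻¹ : H) : (ZMod N)ˣ) * x : ZMod N).val • π (inr a) w := by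
  rw [← unitaryRep_mul_apply, inl_mul_inr, unitaryRep_mul_apply,
    apply_inl_of_apply_inl_one hw, map_smul]

theorem coe_inv_injective : Function.Injective fun a : H => (((a⁻¹ : H) : (ZMod N)ˣ) : ZMod N) :=
  fun _ _ h => inv_injective (Subtype.ext (Units.ext h))

theorem eq_inl_mul_inr (g : ZModSemidirect N H) :
    g = inl (Multiplicative.ofAdd g.left.toAdd) * inr g.right :=
  (inl_left_mul_inr_right g).symm

theorem apply_apply_inr {μ : ℂ} {w : V}
    (hw : π (inl (Multiplicative.ofAdd 1)) w = μ • w) (g : ZModSemidirect N H) (a : H) :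
    π g (π (inr a) w) =
      μ ^ ((((g.right * a)⁻¹ : H) : (ZMod N)ˣ) * g.left.toAdd : ZMod N).val •
        π (inr (g.right * a)) w := by
  conv_lhs => rw [eq_inl_mul_inr g, ← unitaryRep_mul_apply, mul_assoc, ← map_mul inr,
    unitaryRep_mul_apply, apply_inl_apply_inr hw]

/-- These are eigenvectors of one operator with the distinct eigenvalues `μ^(a⁻¹)`. -/
theorem linearIndependent_apply_inr {μ : ℂ} (hμ : IsPrimitiveRoot μ N) {w : V} (hw0 : w ≠ 0)
    (hw : π (inl (Multiplicative.ofAdd 1)) w = μ • w) :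
    LinearIndependent ℂ fun a : H => π (inr a) w := by
  refine Module.End.eigenvectors_linearIndependent'
    (unitaryToRepresentation π (inl (Multiplicative.ofAdd 1)))
    (fun a : H => μ ^ (((a⁻¹ : H) : (ZMod N)ˣ) : ZMod N).val) (fun a b h => ?_) _
    (fun a => ⟨Module.End.mem_eigenspace_iff.2 ?_, by simpa using hw0⟩)
  · exact coe_inv_injective
      (ZMod.val_injective N (hμ.pow_inj (ZMod.val_lt _) (ZMod.val_lt _) h))
  · refine (apply_inl_apply_inr hw 1 a).trans ?_
    rw [mul_one]

theorem span_apply_inr_eq_top (hπ : IsIrreducibleUnitary π) {μ : ℂ} {w : V} (hw0 : w ≠ 0)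
    (hw : π (inl (Multiplicative.ofAdd 1)) w = μ • w) :
    Submodule.span ℂ (Set.range fun a : H => π (inr a) w) = ⊤ := by
  refine hπ.eq_top_of_mem _ (fun g v hv => ?_) (Submodule.subset_span ⟨1, rfl⟩) (by simpa)
  induction hv using Submodule.span_induction with
  | mem v hv =>
    obtain ⟨a, rfl⟩ := hv
    dsimp only
    rw [apply_apply_inr hw]
    exact Submodule.smul_mem _ _ (Submodule.subset_span ⟨_, rfl⟩)
  | zero => simp
  | add x y _ _ hx hy => rw [map_add]; exact add_mem hx hy
  | smul c x _ hx => rw [map_smul]; exact Submodule.smul_mem _ c hx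

theorem exists_isPrimitiveRoot_or_forall_apply_inl_eq [FiniteDimensional ℂ V] [Nontrivial V] :
    ∃ w : V, w ≠ 0 ∧ ((∀ x, π (inl x) w = w) ∨
      ∃ μ : ℂ, IsPrimitiveRoot μ N ∧ π (inl (Multiplicative.ofAdd 1)) w = μ • w) := by
  obtain ⟨μ, hμ⟩ := Module.End.exists_eigenvalue
    (unitaryToRepresentation π (inl (Multiplicative.ofAdd 1)))
  obtain ⟨w, hw, hw0⟩ := hμ.exists_hasEigenvector
  replace hw : π (inl (Multiplicative.ofAdd 1)) w = μ • w := Module.End.mem_eigenspace_iff.1 hw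
  refine ⟨w, hw0, ?_⟩
  by_cases h1 : μ = 1
  · left
    intro x
    have := apply_inl_of_apply_inl_one hw x.toAdd
    rwa [h1, one_pow, one_smul] at this
  · right
    have hN : (unitaryToRepresentation π (inl (Multiplicative.ofAdd 1)) ^ N) w = μ ^ N • w :=
      (Module.End.HasEigenvector.pow_apply ⟨Module.End.mem_eigenspace_iff.2 hw, hw0⟩ N)
    rw [← map_pow, ← map_pow, ← ofAdd_nsmul] at hN
    simp only [nsmul_eq_mul, CharP.cast_eq_zero, zero_mul, ofAdd_zero, map_one,
      Module.End.one_apply] at hN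
    have hpow : μ ^ N = 1 := by
      have : (μ ^ N - 1) • w = 0 := by rw [sub_smul, ← hN, one_smul, sub_self]
      exact sub_eq_zero.1 ((smul_eq_zero.1 this).resolve_right hw0)
    exact ⟨μ, IsPrimitiveRoot.iff_orderOf.2 (orderOf_eq_prime hpow h1), hw⟩

theorem exists_linearIndependent_orbit_of_isPrimitiveRoot (hπ : IsIrreducibleUnitary π) {μ : ℂ}
    (hμ : IsPrimitiveRoot μ N) {w : V} (hw0 : w ≠ 0)
    (hw : π (inl (Multiplicative.ofAdd 1)) w = μ • w) :
    ∃ v : V, v ≠ 0 ∧ ∀ s : Finset (ZModSemidirect N H), s.card = Module.finrank ℂ V →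
      LinearIndependent ℂ fun g : s => π g v := by
  classical
  have := Fintype.ofFinite H
  let E := Module.Basis.mk (linearIndependent_apply_inr hμ hw0 hw)
    (span_apply_inr_eq_top hπ hw0 hw).ge
  have hE : ∀ a, E a = π (inr a) w := fun a => Module.Basis.mk_apply _ _ a
  let idx : H → ℕ := fun a => Fintype.equivFin H a
  have hidx : Function.Injective idx := Fin.val_injective.comp (Fintype.equivFin H).injective
  -- The index table `b⁻¹ * a` is a Latin square, which gives injectivity in each variable.
  obtain ⟨c, hc0, hc⟩ := hμ.exists_forall_det_ne_zero coe_inv_injective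
    (fun b a : H => idx (b⁻¹ * a)) (fun b => hidx.comp (mul_right_injective _))
    (fun a => hidx.comp ((mul_left_injective a).comp inv_injective))
  let v : V := ∑ a, c (idx a) • E a
  -- `π g` permutes the basis lines by `g.right` and scales each by a power of `μ`.
  have hv : ∀ g a, E.repr (π g v) a = c (idx (g.right⁻¹ * a)) *
      μ ^ (((a⁻¹ : H) : (ZMod N)ˣ) * g.left.toAdd : ZMod N).val := fun g a => by
    have : π g v = ∑ a, (c (idx (g.right⁻¹ * a)) *
        μ ^ (((a⁻¹ : H) : (ZMod N)ˣ) * g.left.toAdd : ZMod N).val) • E a := by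
      rw [map_sum, ← Equiv.sum_comp (Equiv.mulLeft g.right) fun a => (c (idx (g.right⁻¹ * a)) *
        μ ^ (((a⁻¹ : H) : (ZMod N)ˣ) * g.left.toAdd : ZMod N).val) • E a]
      refine Finset.sum_congr rfl fun b _ => ?_
      rw [Equiv.coe_mulLeft, inv_mul_cancel_left, map_smul, hE, hE, apply_apply_inr hw, smul_smul]
    rw [this, Module.Basis.repr_sum_self]
  refine ⟨v, fun h0 => hc0 (idx 1) ?_, fun s hs => ?_⟩
  · have := hv 1 1
    simpa [h0] using this.symm
  · let φ : H ≃ s := Fintype.equivOfCardEq <| by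
      rw [Fintype.card_coe, hs, Module.finrank_eq_card_basis E]
    rw [← linearIndependent_equiv φ]
    refine ((Module.Basis.is_basis_iff_det E).2 (isUnit_iff_ne_zero.2 ?_)).1
    rw [Module.Basis.det_apply]
    convert hc (fun i => ((φ i).1.right, (φ i).1.left.toAdd)) (fun i j h =>
      φ.injective (Subtype.ext (SemidirectProduct.ext (congrArg Prod.snd h)
        (congrArg Prod.fst h)))) using 2
    ext a i
    exact hv _ a

theorem exists_linearIndependent_orbit (hπ : IsIrreducibleUnitary π) :
    ∃ v : V, v ≠ 0 ∧ ∀ s : Finset (ZModSemidirect N H), s.card = Module.finrank ℂ V →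
      LinearIndependent ℂ fun g : s => π g v := by
  have := hπ.finiteDimensional
  have := hπ.nontrivial
  obtain ⟨w, hw0, hw | ⟨μ, hμ, hw⟩⟩ := exists_isPrimitiveRoot_or_forall_apply_inl_eq (π := π)
  · refine ⟨w, hw0, fun s hs => ?_⟩
    rw [finrank_eq_one_of_apply_inl_eq hπ hw0 hw, Finset.card_eq_one] at hs
    obtain ⟨g, rfl⟩ := hs
    exact .of_subsingleton ⟨g, Finset.mem_singleton_self g⟩ (by simpa using hw0)
  · exact exists_linearIndependent_orbit_of_isPrimitiveRoot hπ hμ hw0 hw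

theorem exists_isFullSparkFrame_orbit (hπ : IsIrreducibleUnitary π) :
    ∃ v : V, IsFullSparkFrame (fun g : ZModSemidirect N H => π g v) ∧
      IsEqualNorm (fun g : ZModSemidirect N H => π g v) ∧
      IsTightFrame (fun g : ZModSemidirect N H => π g v) := by
  obtain ⟨v, hv0, hv⟩ := exists_linearIndependent_orbit hπ
  have ht := hπ.isTightFrame hv0
  exact ⟨v, ⟨ht.isFrame, hv⟩, fun g h => by simp, ht⟩

end ZModSemidirect

theorem mainTheorem1 (N : ℕ) [Fact N.Prime] (H : Subgroup (ZMod N)ˣ) :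
    IsIrreduciblyFullSpark.{u} (ZModSemidirect N H) ∧
    ∀ (V : Type u) [NormedAddCommGroup V] [InnerProductSpace ℂ V] [CompleteSpace V]
      (π : ZModSemidirect N H →* (V ≃ₗᵢ[ℂ] V)), IsIrreducibleUnitary π →
      ∃ v : V, IsFullSparkFrame (fun g : ZModSemidirect N H => π g v) ∧
        IsEqualNorm (fun g : ZModSemidirect N H => π g v) ∧
        IsTightFrame (fun g : ZModSemidirect N H => π g v) := by
  refine ⟨fun V _ _ _ π hπ => ?_, fun V _ _ _ π hπ =>
    ZModSemidirect.exists_isFullSparkFrame_orbit hπ⟩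
  obtain ⟨v, hv, -⟩ := ZModSemidirect.exists_isFullSparkFrame_orbit hπ
  exact ⟨v, hv⟩
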